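/- Let $k$ be any field, let $Y$ be a smooth curve over $k$, i.e. a $k$-scheme whose structure morphism $Y \to \operatorname{Spec} k$ is smooth of relative dimension $1$, and let $y$ be a closed point of $Y$. Then there exist Nisnevich coordinates around $y$: a Zariski open neighborhood $U \subseteq Y$ of $y$ and an étale morphism of $k$-schemes $\phi : U \to \mathbb{A}^1_k$ such that the induced map on residue fields $k(\phi(y)) \to k(y)$ is an isomorphism. -/

import Mathlib

open CategoryTheory AlgebraicGeometry

universe u

/-- Nisnevich coordinates in dimension `r` around a point `y` of a scheme `Y` over a field `k`
(with structure morphism `f : Y ⟶ Spec k`): a Zariski open neighbourhood `U` of `y` together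
with an étale morphism `φ : U ⟶ 𝔸ʳ_k` of `k`-schemes such that the induced map
`κ(φ(y)) ⟶ κ(y)` on residue fields is an isomorphism. -/
structure NisnevichCoordinates {k : Type u} [Field k] {Y : Scheme.{u}}
    (f : Y ⟶ Spec (CommRingCat.of k)) (r : ℕ) (y : Y) where
  /-- The Zariski open neighbourhood. -/
  U : Y.Opens
  /-- `U` contains `y`. -/
  mem : y ∈ U
  /-- The coordinate map to affine `r`-space over `k`. -/
  φ : U.toScheme ⟶ AffineSpace (ULift.{u} (Fin r)) (Spec (CommRingCat.of k))
  /-- `φ` is a morphism over `k`. -/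
  comp_structure : φ ≫ (AffineSpace (ULift.{u} (Fin r)) (Spec (CommRingCat.of k)) ↘
    Spec (CommRingCat.of k)) = U.ι ≫ f
  /-- `φ` is étale. -/
  etale : Etale φ
  /-- The induced map of residue fields `κ(φ(y)) ⟶ κ(y)` is an isomorphism
  (the residue field of `y` in the open subscheme `U` is that of `y` in `Y`). -/
  residue_iso : IsIso (φ.residueFieldMap ⟨y, mem⟩)

/-! Work on a standard smooth affine neighbourhood with ring `A`, and let `κ` be the residue field
of the point. It suffices to find `t` in `A` whose value generates `κ` over `k` and whose
differential is nonzero in the line `κ ⊗ Ω[A⁄k]`: then `t` is étale near the point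
(`exists_etale_aeval_away`) and surjects onto `κ`. When `k` is imperfect, even simplicity of `κ / k`
needs an argument. Any `a` with `da ≠ 0` in the fibre has differential spanning `Ω[κ⁄k]`, so `κ` is
separable over `k(a)`, and `Field.exists_primitive_element_of_isSeparable_adjoin_simple` gives a
generator. If a lift `t` of it has `dt = 0` in the fibre, then `Ω[κ⁄k] = 0`, and adding a function
vanishing at the point makes `dt` nonzero without changing the value. -/

open IntermediateField in
/-- A finite extension `E / F` which is separable over a simple subextension is simple. -/
theorem Field.exists_primitive_element_of_isSeparable_adjoin_simple
    {F E : Type*} [Field F] [Field E] [Algebra F E] [FiniteDimensional F E] (γ : E)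
    [Algebra.IsSeparable F⟮γ⟯ E] : ∃ α : E, F⟮α⟯ = ⊤ := by
  rcases finite_or_infinite F with _ | _
  · exact Field.exists_primitive_element_of_finite_bot F E
  obtain ⟨q, _⟩ := ExpChar.exists F
  have := expChar_of_injective_algebraMap (algebraMap F E).injective q
  let S := separableClosure F E
  have : ExpChar S q := expChar_of_injective_algebraMap (algebraMap F S).injective q
  obtain ⟨n, s, hs⟩ := IsPurelyInseparable.pow_mem S q γ
  obtain ⟨β, hβ⟩ := Field.exists_primitive_element F S
  have hβS : F⟮(β : E) ^ q ^ n⟯ = S := by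
    rw [← adjoin_simple_eq_adjoin_pow_expChar_pow_of_isSeparable F E
      (mem_separableClosure_iff.mp β.2) q n]
    simpa only [lift_adjoin_simple, lift_top] using congr_arg lift hβ
  have : Finite (IntermediateField F S) :=
    Field.finite_intermediateField_of_exists_primitive_element F S ⟨β, hβ⟩
  -- The generator displayed is `(γ + c • β) ^ q ^ n`, which lies in `S`. Since `S / F` has finitely
  -- many subfields, two values of `c` give the same one, which then contains `β ^ q ^ n`.
  obtain ⟨x, y, hxy, heq⟩ := Finite.exists_ne_map_eq_of_infinite
    fun c : F ↦ F⟮s + c ^ q ^ n • β ^ q ^ n⟯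
  have hne : x ^ q ^ n - y ^ q ^ n ≠ 0 := by
    rw [← sub_pow_expChar_pow]
    exact pow_ne_zero _ (sub_ne_zero.mpr hxy)
  have hmem : β ^ q ^ n ∈ F⟮s + x ^ q ^ n • β ^ q ^ n⟯ := by
    have h₁ := mem_adjoin_simple_self F (s + x ^ q ^ n • β ^ q ^ n)
    have h₂ := mem_adjoin_simple_self F (s + y ^ q ^ n • β ^ q ^ n)
    rw [← show F⟮_⟯ = F⟮_⟯ from heq] at h₂
    have h₃ := sub_mem h₁ h₂
    rw [add_sub_add_left_eq_sub, ← sub_smul] at h₃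
    simpa [smul_smul, inv_mul_cancel₀ hne] using
      IntermediateField.smul_mem _ h₃ (x := (x ^ q ^ n - y ^ q ^ n)⁻¹)
  refine ⟨γ + x • β, ?_⟩
  set L := F⟮γ + x • (β : E)⟯ with hL
  have hpow : (γ + x • (β : E)) ^ q ^ n = ((s + x ^ q ^ n • β ^ q ^ n : S) : E) := by
    rw [add_pow_expChar_pow, smul_pow, ← hs]
    rfl
  have hSL : S ≤ L := by
    rw [← hβS, adjoin_simple_le_iff]
    have h : F⟮((s + x ^ q ^ n • β ^ q ^ n : S) : E)⟯ ≤ L := by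
      rw [adjoin_simple_le_iff, ← hpow]
      exact pow_mem (mem_adjoin_simple_self F _) _
    apply h
    rw [← lift_adjoin_simple]
    exact (mem_lift (β ^ q ^ n)).mpr hmem
  have hγL : F⟮γ⟯ ≤ L := by
    rw [adjoin_simple_le_iff]
    simpa using sub_mem (mem_adjoin_simple_self F (γ + x • (β : E)))
      (IntermediateField.smul_mem L (hSL β.2) (x := x))
  let := (IntermediateField.inclusion hγL).toAlgebra
  have : IsScalarTower F⟮γ⟯ L E := .of_algebraMap_eq fun _ ↦ rfl
  -- `E / L` is separable because `γ ∈ L`, and purely inseparable because `S ≤ L`; hence `L = E`.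
  have : Algebra.IsSeparable L E := Algebra.isSeparable_tower_top_of_isSeparable F⟮γ⟯ L E
  let := (IntermediateField.inclusion hSL).toAlgebra
  have : IsScalarTower S L E := .of_algebraMap_eq fun _ ↦ rfl
  have : IsPurelyInseparable L E := .tower_top S L E
  rw [eq_top_iff]
  intro z _
  obtain ⟨w, rfl⟩ := IsPurelyInseparable.surjective_algebraMap_of_isSeparable L E z
  exact w.2

section

open TensorProduct KaehlerDifferential

/-- The differentials of a simple algebraic extension vanish if the differential of a generator
does. -/
theorem KaehlerDifferential.subsingleton_of_adjoin_simple_eq_top {k κ : Type*} [Field k] [Field κ]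
    [Algebra k κ] [Algebra.IsAlgebraic k κ] {α : κ} (hα : IntermediateField.adjoin k {α} = ⊤)
    (h : D k κ α = 0) : Subsingleton Ω[κ⁄k] := by
  rw [← Submodule.subsingleton_iff κ, ← subsingleton_iff_bot_eq_top, eq_comm,
    ← span_range_derivation, Submodule.span_eq_bot]
  rintro _ ⟨z, rfl⟩
  have hz : z ∈ (IntermediateField.adjoin k {α}).toSubalgebra := by simp [hα]
  rw [IntermediateField.adjoin_simple_toSubalgebra_of_isAlgebraic
    (Algebra.IsAlgebraic.isAlgebraic α), Algebra.adjoin_singleton_eq_range_aeval] at hz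
  obtain ⟨p, rfl⟩ := hz
  simp [Derivation.map_aeval, h]

/-- If `Ω[κ⁄k]` is spanned by `dγ`, then the finite extension `κ / k(γ)` is separable. -/
theorem isSeparable_adjoin_simple_of_span_D_eq_top {k κ : Type*} [Field k] [Field κ]
    [Algebra k κ] [FiniteDimensional k κ] {γ : κ}
    (h : Submodule.span κ {D k κ γ} = ⊤) :
    Algebra.IsSeparable (IntermediateField.adjoin k {γ}) κ := by
  let K := IntermediateField.adjoin k {γ}
  have : Subsingleton Ω[κ⁄K] := by
    rw [← Submodule.subsingleton_iff κ, ← subsingleton_iff_bot_eq_top, eq_comm,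
      ← LinearMap.range_eq_top.mpr (map_surjective k K κ), LinearMap.range_eq_map, ← h,
      Submodule.map_span, Set.image_singleton, map_D, Submodule.span_singleton_eq_bot]
    exact (D K κ).map_algebraMap ⟨γ, IntermediateField.mem_adjoin_simple_self k γ⟩
  have : Algebra.FormallyUnramified K κ := ⟨this⟩
  have : Module.Finite K κ := .of_restrictScalars_finite k K κ
  exact Algebra.FormallyUnramified.isSeparable K κ

/-- On a standard smooth algebra of relative dimension one over a field, there is a function whose
value generates a given residue field and whose differential does not vanish there. -/
theorem exists_adjoin_simple_eq_top_and_D_ne_zero {k A κ : Type*} [Field k] [CommRing A] [Field κ]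
    [Algebra k A] [Algebra k κ] [Algebra A κ] [IsScalarTower k A κ]
    [Algebra.IsStandardSmoothOfRelativeDimension 1 k A]
    (hsurj : Function.Surjective (algebraMap A κ)) :
    ∃ t : A, IntermediateField.adjoin k {algebraMap A κ t} = ⊤ ∧
      (1 ⊗ₜ[A] D k A t : κ ⊗[A] Ω[A⁄k]) ≠ 0 := by
  have : Nontrivial A := (algebraMap A κ).domain_nontrivial
  have : Algebra.IsStandardSmooth k A :=
    Algebra.IsStandardSmoothOfRelativeDimension.isStandardSmooth 1
  have : Algebra.FiniteType k κ := .of_surjective (IsScalarTower.toAlgHom k A κ) hsurj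
  have : Module.Finite k κ := finite_of_finite_type_of_isJacobsonRing k κ
  have hrank : Module.finrank κ (κ ⊗[A] Ω[A⁄k]) = 1 := by
    rw [Module.finrank_baseChange, Module.finrank,
      Algebra.IsStandardSmoothOfRelativeDimension.rank_kaehlerDifferential 1, Nat.cast_one,
      Cardinal.one_toNat]
  have hD (a : A) : mapBaseChange k A κ (1 ⊗ₜ D k A a) = D k κ (algebraMap A κ a) := by simp
  obtain ⟨a, ha⟩ : ∃ a : A, (1 ⊗ₜ[A] D k A a : κ ⊗[A] Ω[A⁄k]) ≠ 0 := by
    by_contra! h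
    have hzero : TensorProduct.mk A κ Ω[A⁄k] 1 = 0 :=
      LinearMap.ext_on_range (span_range_derivation k A) h
    have : Subsingleton (κ ⊗[A] Ω[A⁄k]) := by
      refine subsingleton_of_forall_eq 0 fun x ↦ ?_
      induction x with
      | zero => rfl
      | add x y hx hy => rw [hx, hy, add_zero]
      | tmul z ω =>
        rw [← mul_one z, ← smul_eq_mul, ← TensorProduct.smul_tmul',
          show (1 ⊗ₜ[A] ω : κ ⊗[A] Ω[A⁄k]) = 0 from LinearMap.congr_fun hzero ω, smul_zero]
    simp [Module.finrank_zero_of_subsingleton] at hrank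
  have hspan : Submodule.span κ {D k κ (algebraMap A κ a)} = ⊤ := by
    rw [← hD, ← Set.image_singleton, ← Submodule.map_span,
      (finrank_eq_one_iff_of_nonzero _ ha).mp hrank, Submodule.map_top, LinearMap.range_eq_top]
    exact mapBaseChange_surjective k A κ hsurj
  have := isSeparable_adjoin_simple_of_span_D_eq_top hspan
  obtain ⟨α, hα⟩ := Field.exists_primitive_element_of_isSeparable_adjoin_simple (F := k)
    (algebraMap A κ a)
  obtain ⟨t, rfl⟩ := hsurj α
  by_cases ht : (1 ⊗ₜ[A] D k A t : κ ⊗[A] Ω[A⁄k]) = 0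
  · have := subsingleton_of_adjoin_simple_eq_top hα (by rw [← hD, ht, map_zero])
    -- As `Ω[κ⁄k] = 0`, the conormal sequence provides `y` in the kernel of `A → κ` with the same
    -- differential as `a` in the fibre.
    obtain ⟨x, hx⟩ := (exact_kerCotangentToTensor_mapBaseChange k A κ hsurj (1 ⊗ₜ D k A a)).mp
      (Subsingleton.elim _ _)
    obtain ⟨y, rfl⟩ := Ideal.toCotangent_surjective _ x
    rw [kerCotangentToTensor_toCotangent] at hx
    refine ⟨t + y, ?_, ?_⟩
    · rwa [map_add, RingHom.mem_ker.mp y.2, add_zero]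
    · rwa [map_add, TensorProduct.tmul_add, ht, zero_add, hx]
  · exact ⟨t, hα, ht⟩

/-- A map `P → B` of `R`-algebras with `B` smooth over `R` is étale if it induces an isomorphism
on differentials over `R`. -/
theorem Algebra.Etale.of_bijective_mapBaseChange {R P B : Type*} [CommRing R] [CommRing P]
    [CommRing B] [Algebra R P] [Algebra R B] [Algebra P B] [IsScalarTower R P B]
    [Algebra.FiniteType R P] [Algebra.Smooth R B] (h : Function.Bijective (mapBaseChange R P B)) :
    Algebra.Etale P B := by
  have hΩ : Subsingleton Ω[B⁄P] := by
    refine subsingleton_of_forall_eq 0 fun x ↦ ?_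
    obtain ⟨y, rfl⟩ := map_surjective R P B x
    exact (exact_mapBaseChange_map R P B y).mpr (h.2 y)
  -- Jacobi–Zariski sequence: injectivity on differentials kills `δ`, and `H1Cotangent R B` vanishes
  -- by smoothness.
  have hH : Subsingleton (Algebra.H1Cotangent P B) := by
    refine subsingleton_of_forall_eq 0 fun x ↦ ?_
    have hx : Algebra.H1Cotangent.δ R P B x = 0 := h.1 <| by
      rw [map_zero]
      exact (Algebra.H1Cotangent.exact_δ_mapBaseChange R P B _).mpr ⟨x, rfl⟩
    obtain ⟨y, rfl⟩ := (Algebra.H1Cotangent.exact_map_δ R P B x).mp hx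
    rw [Subsingleton.elim y 0, map_zero]
  have : Algebra.FormallyUnramified P B := ⟨hΩ⟩
  have : Algebra.FormallySmooth P B := ⟨inferInstance, hH⟩
  exact ⟨.of_formallyUnramified_and_formallySmooth,
    .of_restrict_scalars_finitePresentation R P B⟩

/-- A function on a smooth algebra of relative dimension one whose differential is a basis of the
module of differentials defines an étale map from the polynomial ring in one variable. -/
theorem MvPolynomial.etale_aeval_of_basis {R B σ ι : Type*} [Unique σ] [Unique ι] [CommRing R]
    [CommRing B] [Algebra R B] [Algebra.Smooth R B] (t : B) (b : Module.Basis ι B Ω[B⁄R])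
    (hb : b default = D R B t) :
    (MvPolynomial.aeval (R := R) fun _ : σ ↦ t).toRingHom.Etale := by
  let f := MvPolynomial.aeval (R := R) fun _ : σ ↦ t
  let := f.toRingHom.toAlgebra
  have : IsScalarTower R (MvPolynomial σ R) B := .of_algebraMap_eq' f.comp_algebraMap.symm
  let c := ((mvPolynomialBasis R σ).baseChange B).reindex (Equiv.ofUnique σ ι)
  refine Algebra.Etale.of_bijective_mapBaseChange (R := R) (P := MvPolynomial σ R) ?_
  have : mapBaseChange R (MvPolynomial σ R) B = (c.equiv b (.refl ι)).toLinearMap := by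
    refine c.ext fun i ↦ ?_
    rw [LinearEquiv.coe_coe, Module.Basis.equiv_apply, Equiv.refl_apply, Unique.eq_default i, hb]
    simp only [c, Module.Basis.reindex_apply, Module.Basis.baseChange_apply, mvPolynomialBasis_apply,
      mapBaseChange_tmul, map_D, one_smul]
    congr 1
    exact MvPolynomial.aeval_X _ _
  rw [this]
  exact (c.equiv b (.refl ι)).bijective

/-- A function on a smooth algebra of relative dimension one is an étale coordinate near every point
where its differential does not vanish. -/
theorem exists_etale_aeval_away {k A κ : Type*} (σ : Type*) [Unique σ] [Field k] [CommRing A]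
    [Field κ] [Algebra k A] [Algebra A κ] [Algebra.IsStandardSmoothOfRelativeDimension 1 k A]
    (t : A) (ht : (1 ⊗ₜ[A] D k A t : κ ⊗[A] Ω[A⁄k]) ≠ 0) :
    ∃ g : A, algebraMap A κ g ≠ 0 ∧
      (MvPolynomial.aeval (R := k)
        fun _ : σ ↦ algebraMap A (Localization.Away g) t).toRingHom.Etale := by
  have : Nontrivial A := (algebraMap A κ).domain_nontrivial
  have : Algebra.IsStandardSmooth k A :=
    Algebra.IsStandardSmoothOfRelativeDimension.isStandardSmooth 1
  let b : Module.Basis Unit A Ω[A⁄k] := Module.basisUnique Unit <| by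
    rw [Module.finrank, Algebra.IsStandardSmoothOfRelativeDimension.rank_kaehlerDifferential 1,
      Nat.cast_one, Cardinal.one_toNat]
  -- Inverting the coefficient of `dt` in a basis makes `dt` itself a basis.
  let g := b.repr (D k A t) ()
  have hg : g • b () = D k A t := by simpa using b.sum_repr (D k A t)
  refine ⟨g, fun h ↦ ht ?_, ?_⟩
  · rw [← hg, TensorProduct.tmul_smul, TensorProduct.smul_tmul', Algebra.smul_def, h, zero_mul,
      TensorProduct.zero_tmul]
  let B := Localization.Away g
  have : Algebra.FormallyEtale A B := .of_isLocalization (Submonoid.powers g)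
  have : Algebra.Smooth k B := ⟨inferInstance, inferInstance⟩
  obtain ⟨u, hu⟩ := IsLocalization.Away.algebraMap_isUnit (S := B) g
  let c := ((b.baseChange B).map (tensorKaehlerEquivOfFormallyEtale k A B)).unitsSMul fun _ ↦ u
  refine MvPolynomial.etale_aeval_of_basis _ c ?_
  rw [← map_D k k A B t, ← hg]
  simp [c, Module.Basis.unitsSMul_apply, Units.smul_def, hu]

/-- Near a maximal ideal `m` of a standard smooth algebra of relative dimension one over a field,
there is an étale coordinate that induces a surjection onto the residue field of `m`. -/
theorem exists_etale_away_forall_exists_sub_mem {k A : Type*} (σ : Type*) [Unique σ] [Field k]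
    [CommRing A] [Algebra k A] [Algebra.IsStandardSmoothOfRelativeDimension 1 k A]
    (m : Ideal A) [m.IsMaximal] :
    ∃ g ∉ m, ∃ v : MvPolynomial σ k →ₐ[k] Localization.Away g, v.toRingHom.Etale ∧
      ∀ b, ∃ p, b - v p ∈ m.map (algebraMap A (Localization.Away g)) := by
  let := Ideal.Quotient.field m
  obtain ⟨t, htop, ht⟩ := exists_adjoin_simple_eq_top_and_D_ne_zero (k := k) (A := A) (κ := A ⧸ m)
    Ideal.Quotient.mk_surjective
  obtain ⟨g, hg, hv⟩ := exists_etale_aeval_away σ t ht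
  refine ⟨g, fun h ↦ hg (Ideal.Quotient.eq_zero_iff_mem.mpr h), _, hv, fun b ↦ ?_⟩
  obtain ⟨n, a, ha⟩ := IsLocalization.Away.surj g b
  obtain ⟨h, hh⟩ := Ideal.Quotient.mk_surjective (Ideal.Quotient.mk m g ^ n)⁻¹
  have hz : Ideal.Quotient.mk m (a * h) ∈
      (IntermediateField.adjoin k {algebraMap A (A ⧸ m) t}).toSubalgebra := by rw [htop]; trivial
  have : Algebra.IsStandardSmooth k A :=
    Algebra.IsStandardSmoothOfRelativeDimension.isStandardSmooth 1
  have : Module.Finite k (A ⧸ m) := finite_of_finite_type_of_isJacobsonRing k (A ⧸ m)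
  rw [IntermediateField.adjoin_simple_toSubalgebra_of_isAlgebraic
    (Algebra.IsAlgebraic.isAlgebraic _), Algebra.adjoin_singleton_eq_range_aeval] at hz
  obtain ⟨p, hp⟩ := hz
  have hp' : a * h - Polynomial.aeval t p ∈ m := by
    rw [← Ideal.Quotient.mk_eq_mk_iff_sub_mem, ← hp]
    exact Polynomial.aeval_algebraMap_apply (A ⧸ m) t p
  have hg' : 1 - g ^ n * h ∈ m := by
    rw [← Ideal.Quotient.mk_eq_mk_iff_sub_mem, map_mul, map_pow, hh, map_one]
    exact (mul_inv_cancel₀ (pow_ne_zero n hg)).symm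
  refine ⟨Polynomial.aeval (MvPolynomial.X default) p, ?_⟩
  rw [← Polynomial.aeval_algHom_apply, MvPolynomial.aeval_X, Polynomial.aeval_algebraMap_apply]
  -- With `b * g ^ n = a`, one has `b - p(t) = b * (1 - g ^ n * h) + (a * h - p(t))`.
  have := add_mem (Ideal.mul_mem_left _ b (Ideal.mem_map_of_mem (algebraMap A _) hg'))
    (Ideal.mem_map_of_mem (algebraMap A (Localization.Away g)) hp')
  convert this using 1
  simp only [map_sub, map_mul, map_one, map_pow, ← ha]
  ring

end

theorem AlgebraicGeometry.isIso_residueFieldMap {X Y : Scheme.{u}} (f : X ⟶ Y)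
    [IsOpenImmersion f] (x : X) : IsIso (f.residueFieldMap x) :=
  inferInstance

theorem AlgebraicGeometry.isIso_residueFieldMap_comp {X Y Z : Scheme.{u}} (f : X ⟶ Y) (g : Y ⟶ Z)
    {x : X} {y : Y} (hy : f x = y) [hf : IsIso (f.residueFieldMap x)] [IsIso (g.residueFieldMap y)] :
    IsIso ((f ≫ g).residueFieldMap x) := by
  subst hy
  rw [Scheme.residueFieldMap_comp]
  exact IsIso.comp_isIso' ‹_› ‹_›

/-- Étale coordinates on a scheme `W` transport along an open immersion `W ⟶ Y`. -/
noncomputable def NisnevichCoordinates.ofIsOpenImmersion {k : Type u} [Field k] {W Y : Scheme.{u}}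
    (f : Y ⟶ Spec (CommRingCat.of k)) (r : ℕ) (j : W ⟶ Y) [IsOpenImmersion j] (w : W)
    (ψ : W ⟶ AffineSpace (ULift.{u} (Fin r)) (Spec (CommRingCat.of k)))
    (hψ : ψ ≫ (AffineSpace (ULift.{u} (Fin r)) (Spec (CommRingCat.of k)) ↘
      Spec (CommRingCat.of k)) = j ≫ f)
    [Etale ψ] [IsIso (ψ.residueFieldMap w)] : NisnevichCoordinates f r (j w) where
  U := j.opensRange
  mem := ⟨w, rfl⟩
  φ := j.isoOpensRange.inv ≫ ψ
  comp_structure := by rw [Category.assoc, hψ, Scheme.Hom.isoOpensRange_inv_comp_assoc]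
  etale := inferInstance
  residue_iso := by
    refine isIso_residueFieldMap_comp j.isoOpensRange.inv ψ (y := w)
      (hf := isIso_residueFieldMap _ _) ?_
    apply j.isOpenEmbedding.injective
    exact congr($(Scheme.Hom.isoOpensRange_inv_comp j) ⟨j w, ⟨w, rfl⟩⟩)

/-- A map of affine schemes induces an isomorphism on residue fields at a closed point if every
function on the source agrees at that point with a function pulled back from the target. -/
theorem AlgebraicGeometry.isIso_residueFieldMap_SpecMap {R S : CommRingCat.{u}} (v : R ⟶ S)
    (w : Spec S) [w.asIdeal.IsMaximal] (h : ∀ b, ∃ p, b - v p ∈ w.asIdeal) :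
    IsIso ((Spec.map v).residueFieldMap w) := by
  have key (b : S) : (Spec S).Γevaluation w ((Scheme.ΓSpecIso S).inv b) =
      (Scheme.Spec.residueFieldIso S w).inv (algebraMap S w.asIdeal.ResidueField b) :=
    (congr($(Scheme.Spec.algebraMap_residueFieldIso_inv S w) b)).symm
  rw [ConcreteCategory.isIso_iff_bijective]
  refine ⟨RingHom.injective ((Spec.map v).residueFieldMap w).hom, fun z ↦ ?_⟩
  obtain ⟨b, hb⟩ := Ideal.algebraMap_residueField_surjective w.asIdeal
    ((Scheme.Spec.residueFieldIso S w).hom z)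
  obtain ⟨p, hp⟩ := h b
  refine ⟨(Spec R).Γevaluation _ ((Scheme.ΓSpecIso R).inv p), ?_⟩
  rw [Scheme.Γevaluation_naturality_apply]
  have : (Spec.map v).appTop ((Scheme.ΓSpecIso R).inv p) = (Scheme.ΓSpecIso S).inv (v p) :=
    (congr($(Scheme.ΓSpecIso_inv_naturality v) p)).symm
  rw [this, key]
  have hbp : algebraMap S w.asIdeal.ResidueField (v p) = algebraMap S w.asIdeal.ResidueField b := by
    rw [eq_comm, ← sub_eq_zero, ← map_sub, Ideal.algebraMap_residueField_eq_zero]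
    exact hp
  rw [hbp, hb]
  simp

/-- Every closed point of a smooth curve over an arbitrary field admits Nisnevich coordinates. -/
theorem proposition4p3 {k : Type u} [Field k] {Y : Scheme.{u}}
    (f : Y ⟶ Spec (CommRingCat.of k)) (hf : SmoothOfRelativeDimension 1 f)
    (y : Y) (hy : IsClosed ({y} : Set Y)) :
    Nonempty (NisnevichCoordinates f 1 y) := by
  obtain ⟨U, hU, V, hV, hyV, e, hUV⟩ := hf.exists_isStandardSmoothOfRelativeDimension y
  -- `Spec k` has a single point.
  obtain rfl : U = ⊤ := by
    ext x
    simp [Subsingleton.elim x (f y), show f y ∈ U from e hyV]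
  let β : CommRingCat.of k ⟶ Γ(Y, V) := (Scheme.ΓSpecIso _).inv ≫ f.appLE ⊤ V e
  have hβ : Spec.map β = hV.fromSpec ≫ f := by
    rw [← IsAffineOpen.SpecMap_appLE_fromSpec f hU hV e, IsAffineOpen.fromSpec_top,
      Scheme.isoSpec_Spec_inv, ← Spec.map_comp]
  have hβ' : β.hom.IsStandardSmoothOfRelativeDimension 1 :=
    RingHom.isStandardSmoothOfRelativeDimension_respectsIso.2 _
      (Scheme.ΓSpecIso (.of k)).symm.commRingCatIsoToRingEquiv hUV
  algebraize [β.hom]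
  obtain ⟨x, rfl⟩ : ∃ x, hV.fromSpec x = y := by rwa [← Set.mem_range, hV.range_fromSpec]
  have hx : IsClosed {x} := by
    convert hy.preimage hV.fromSpec.continuous
    ext
    simp [hV.fromSpec.isOpenEmbedding.injective.eq_iff]
  have := (PrimeSpectrum.isClosed_singleton_iff_isMaximal x).mp hx
  obtain ⟨g, hg, v, hv, hvx⟩ :=
    exists_etale_away_forall_exists_sub_mem (k := k) (ULift.{u} (Fin 1)) x.asIdeal
  let i : Γ(Y, V) ⟶ .of (Localization.Away g) := CommRingCat.ofHom (algebraMap _ _)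
  have : IsOpenImmersion (Spec.map i) := inferInstance
  obtain ⟨w, rfl⟩ : ∃ w, Spec.map i w = x :=
    (PrimeSpectrum.localization_away_comap_range (Localization.Away g) g).ge hg
  have hw : IsClosed {w} := by
    convert hx.preimage (Spec.map i).continuous
    ext
    simp [(Spec.map i).isOpenEmbedding.injective.eq_iff]
  have := (PrimeSpectrum.isClosed_singleton_iff_isMaximal w).mp hw
  let v' : CommRingCat.of (MvPolynomial (ULift.{u} (Fin 1)) (CommRingCat.of k)) ⟶
      .of (Localization.Away g) :=
    CommRingCat.ofHom v.toRingHom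
  have : IsIso ((Spec.map v').residueFieldMap w) :=
    isIso_residueFieldMap_SpecMap v' w fun b ↦ (hvx b).imp fun p hp ↦ Ideal.map_comap_le hp
  have : Etale (Spec.map v') := HasRingHomProperty.Spec_iff.mpr hv
  let ψ : Spec (.of (Localization.Away g)) ⟶
      AffineSpace (ULift.{u} (Fin 1)) (Spec (CommRingCat.of k)) :=
    Spec.map v' ≫ (AffineSpace.SpecIso (ULift.{u} (Fin 1)) (.of k)).inv
  have : IsIso (ψ.residueFieldMap w) := isIso_residueFieldMap_comp _ _ rfl
  have : Etale ψ := inferInstanceAs (Etale (Spec.map v' ≫ _))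
  exact ⟨.ofIsOpenImmersion f 1 (Spec.map i ≫ hV.fromSpec) w ψ <| by
    rw [Category.assoc, AffineSpace.SpecIso_inv_over, Category.assoc, ← hβ, ← Spec.map_comp,
      ← Spec.map_comp]
    congr 1
    ext c
    exact v.commutes c⟩
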